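/- Theorem 2 (Dancs-He series for $\zeta(3)$). For each integer $n\ge 0$ let $E_n(x)$ denote the Euler polynomial of degree $n$, defined by the generating function $\frac{2e^{xt}}{e^t+1}=\sum_{n=0}^{\infty}E_n(x)\,\frac{t^n}{n!}$, and let $\zeta$ denote the Riemann zeta function. Then the series below converges absolutely and $$\frac{\pi^2}{9}\,\ln 4\;-\;\frac{2\pi^4}{3}\,\sum_{m=0}^{\infty}(-1)^m\,\frac{\pi^{2m}}{(2m+5)!}\,E_{2m+1}(1)\;=\;\zeta(3).$$ -/

import Mathlib

/-- The Euler polynomials `E_n(X)`, the polynomials with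
`2 e^{xt} / (e^t + 1) = ∑ E_n(x) t^n / n!` (see `eulerPolynomial_generating_function`).
They are given here by the recursion obtained by multiplying out the denominator:
`2 E_n(X) + ∑_{k < n} (n choose k) E_k(X) = 2 X^n`. -/
noncomputable def eulerPolynomial (n : ℕ) : Polynomial ℚ :=
  Polynomial.X ^ n -
    Polynomial.C (1 / 2 : ℚ) * ∑ k : Fin n, (n.choose k : Polynomial ℚ) * eulerPolynomial k

theorem eulerPolynomial_recursion (n : ℕ) :
    ∑ k ∈ Finset.range (n + 1), (n.choose k : Polynomial ℚ) * eulerPolynomial k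
      + eulerPolynomial n = 2 * Polynomial.X ^ n := by
  have h := eulerPolynomial.eq_1 n
  rw [Fin.sum_univ_eq_sum_range
    (fun k => (n.choose k : Polynomial ℚ) * eulerPolynomial k) n] at h
  have hC : (2 : Polynomial ℚ) * Polynomial.C (1 / 2 : ℚ) = 1 := by
    rw [show (2 : Polynomial ℚ) = Polynomial.C 2 from rfl, ← Polynomial.C_mul]
    norm_num
  rw [Finset.sum_range_succ, Nat.choose_self, Nat.cast_one, one_mul]
  linear_combination 2 * h -
    (∑ k ∈ Finset.range n, (n.choose k : Polynomial ℚ) * eulerPolynomial k) * hC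

/-- The defining generating function of the Euler polynomials, as formal power series in `t`
over `ℚ[X]`: `(∑ E_n(X) t^n / n!) (e^t + 1) = 2 e^{Xt}`. -/
theorem eulerPolynomial_generating_function :
    (PowerSeries.mk fun n : ℕ => ((1 / n.factorial : ℚ) • eulerPolynomial n)) *
        (PowerSeries.exp (Polynomial ℚ) + 1) =
      2 * PowerSeries.rescale Polynomial.X (PowerSeries.exp (Polynomial ℚ)) := by
  ext1 n
  have hr := congrArg (fun p => (1 / n.factorial : ℚ) • p) (eulerPolynomial_recursion n)
  have h2 : (2 : PowerSeries (Polynomial ℚ)) = PowerSeries.C 2 :=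
    (map_ofNat PowerSeries.C 2).symm
  rw [mul_add, mul_one, map_add, PowerSeries.coeff_mul, PowerSeries.coeff_mk, h2,
    PowerSeries.coeff_C_mul, PowerSeries.coeff_rescale, PowerSeries.coeff_exp,
    Finset.Nat.sum_antidiagonal_eq_sum_range_succ_mk]
  simp only [smul_add, Finset.smul_sum] at hr
  have key : ∀ k ∈ Finset.range (n + 1),
      PowerSeries.coeff k (PowerSeries.mk fun n : ℕ => ((1 / n.factorial : ℚ) • eulerPolynomial n))
        * PowerSeries.coeff (n - k) (PowerSeries.exp (Polynomial ℚ)) =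
      (1 / n.factorial : ℚ) • ((n.choose k : Polynomial ℚ) * eulerPolynomial k) := by
    intro k hk
    have hk' : k ≤ n := Nat.lt_succ_iff.mp (Finset.mem_range.mp hk)
    rw [PowerSeries.coeff_mk, PowerSeries.coeff_exp, mul_comm, ← Algebra.smul_def, smul_smul,
      ← nsmul_eq_mul, ← Nat.cast_smul_eq_nsmul ℚ, smul_smul, Nat.cast_choose ℚ hk']
    congr 1
    field_simp
  rw [Finset.sum_congr rfl key, hr, Algebra.smul_def]
  ring

/-! Write λ(s) = ∑ n^(-s) over odd n ≥ 1. Euler's formula for ζ(2m+2) turns the m-th term of the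
series into 4/π² · λ(2m+2)/((2m+2)(2m+3)(2m+4)(2m+5)). The reciprocal product is a Beta integral,
(1/6) ∫₀¹ x³(1-x)^(2m+1) dx, and ∑ λ(2m+2) y^(2m+1) = (π/4) tan(πy/2). With y = 1 - x, termwise
integration gives (π/24) ∫₀¹ x³ cot(πx/2) dx (`hasSum_oddZeta_div`).

That integral is computed from the formal expansion cot(πx/2) = 2 ∑ sin(kπx). The truncation error
is an explicit oscillatory integral that vanishes by Riemann–Lebesgue; the sine moments of x³
produce ∑ (-1)^k/k = -ln 2 and ∑ (-1)^k/k³ = -(3/4) ζ(3). -/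

open Filter Topology

/-! ### Euler polynomials at 1 and even zeta values -/

/-- Evaluating the Euler polynomials at `1` in terms of Bernoulli numbers. -/
theorem eulerPolynomial_eval_one (n : ℕ) :
    (eulerPolynomial n).eval 1 = 2 * (2 ^ (n + 1) - 1) * bernoulli' (n + 1) / (n + 1) := by
  have hE := congrArg (PowerSeries.map (Polynomial.evalRingHom (1 : ℚ)))
    eulerPolynomial_generating_function
  have hR : PowerSeries.map (Polynomial.evalRingHom (1 : ℚ))
      (PowerSeries.rescale Polynomial.X (PowerSeries.exp (Polynomial ℚ))) = PowerSeries.exp ℚ := by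
    ext k
    simp [PowerSeries.coeff_rescale, PowerSeries.coeff_exp]
  simp only [map_mul, map_add, map_one, map_ofNat, hR, PowerSeries.map_exp] at hE
  set P := PowerSeries.map (Polynomial.evalRingHom (1 : ℚ))
    (PowerSeries.mk fun n : ℕ => ((1 / n.factorial : ℚ) • eulerPolynomial n)) with hP
  have hB := bernoulli'PowerSeries_mul_exp_sub_one ℚ
  have hB2 := congrArg (PowerSeries.rescale (2 : ℚ)) hB
  have he := PowerSeries.exp_pow_eq_rescale_exp (A := ℚ) 2
  simp only [Nat.cast_ofNat] at he
  simp only [map_mul, map_sub, map_one, ← he, PowerSeries.rescale_X] at hB2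
  have h2 : PowerSeries.C (2 : ℚ) = 2 := map_ofNat _ 2
  rw [h2] at hB2
  -- With B(t) = t e^t/(e^t - 1), this is 2t e^t/(e^t + 1) = 2(B(2t) - B(t)), from e^(2t) - 1 = (e^t
  -- - 1)(e^t + 1).
  have key : PowerSeries.X * P =
      2 * (PowerSeries.rescale (2 : ℚ) (bernoulli'PowerSeries ℚ) - bernoulli'PowerSeries ℚ) := by
    have h1 : PowerSeries.exp ℚ - 1 ≠ 0 := by
      intro h
      have := congrArg (PowerSeries.coeff 1) h
      simp [PowerSeries.coeff_exp, PowerSeries.coeff_one] at this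
    have h3 : PowerSeries.exp ℚ + 1 ≠ 0 := by
      intro h
      have := congrArg (PowerSeries.coeff 0) h
      norm_num at this
    apply mul_right_cancel₀ (mul_ne_zero h1 h3)
    linear_combination (PowerSeries.X * (PowerSeries.exp ℚ - 1)) * hE - 2 * hB2
      + 2 * (PowerSeries.exp ℚ + 1) * hB
  have hc := congrArg (PowerSeries.coeff (n + 1)) key
  rw [← h2, PowerSeries.coeff_succ_X_mul, PowerSeries.coeff_C_mul, map_sub,
    PowerSeries.coeff_rescale, hP, PowerSeries.coeff_map, PowerSeries.coeff_mk,
    bernoulli'PowerSeries, PowerSeries.coeff_mk] at hc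
  simp only [Polynomial.coe_evalRingHom, Polynomial.eval_smul, smul_eq_mul, eq_ratCast,
    Rat.cast_id, Nat.factorial_succ] at hc
  have hf : (n.factorial : ℚ) ≠ 0 := by positivity
  have hn : (n : ℚ) + 1 ≠ 0 := by positivity
  push_cast at hc
  field_simp at hc ⊢
  linear_combination hc

/-- `∑ 1 / n ^ (2 m + 2)` over the odd positive integers `n`, in the form `(1 - 2 ^ (-s)) ζ(s)`. -/
noncomputable def oddZeta (m : ℕ) : ℝ :=
  (1 - 1 / 2 ^ (2 * m + 2)) * ∑' n : ℕ, 1 / ((n : ℝ) + 1) ^ (2 * m + 2)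

theorem tsum_one_div_succ_pow (m : ℕ) :
    ∑' n : ℕ, 1 / ((n : ℝ) + 1) ^ (2 * m + 2) = (-1 : ℝ) ^ m * 2 ^ (2 * m + 1) *
      Real.pi ^ (2 * m + 2) * bernoulli (2 * m + 2) / (2 * m + 2).factorial := by
  have h := hasSum_zeta_nat (Nat.succ_ne_zero m)
  rw [← hasSum_nat_add_iff' 1] at h
  have h' := h.tsum_eq
  simp only [Nat.succ_eq_add_one, mul_add, mul_one, Nat.cast_add, Nat.cast_one] at h'
  rw [h']
  simp [pow_succ]

theorem eulerPolynomial_eval_one_eq_oddZeta (m : ℕ) :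
    (-1 : ℝ) ^ m * (Real.pi ^ (2 * m) / ((2 * m + 5).factorial : ℝ)) *
      (((eulerPolynomial (2 * m + 1)).eval 1 : ℚ) : ℝ) =
    4 / Real.pi ^ 2 * (oddZeta m /
      ((2 * m + 2) * (2 * m + 3) * (2 * m + 4) * (2 * m + 5))) := by
  rw [oddZeta, tsum_one_div_succ_pow, eulerPolynomial_eval_one,
    bernoulli_eq_bernoulli'_of_ne_one (by omega)]
  have hf : ((2 * m + 1).factorial : ℝ) ≠ 0 := by positivity
  have h2 : (2 * m + 2).factorial = (2 * m + 2) * (2 * m + 1).factorial := Nat.factorial_succ _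
  have h5 : (2 * m + 5).factorial =
      (2 * m + 5) * ((2 * m + 4) * ((2 * m + 3) * (2 * m + 2).factorial)) := by
    rw [Nat.factorial_succ, Nat.factorial_succ, Nat.factorial_succ]
  rw [h5, h2]
  have hpi := Real.pi_ne_zero
  push_cast
  rw [show (2 : ℝ) * m + 1 + 1 = 2 * m + 2 by ring]
  field_simp
  ring

/-! ### Cotangent and tangent power series -/

theorem hasSum_cot_series {x : ℝ} (hx0 : 0 < x) (hx1 : x < 1) :
    HasSum (fun n : ℕ => x / (((n : ℝ) + 1) ^ 2 - x ^ 2))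
      ((1 / x - Real.pi * Real.cot (Real.pi * x)) / 2) := by
  have hmem : (x : ℂ) ∈ Complex.integerComplement := by
    rw [Complex.mem_integerComplement_iff]
    rintro ⟨n, hn⟩
    have hn' : (n : ℝ) = x := by exact_mod_cast hn
    rw [← hn'] at hx0 hx1
    norm_cast at hx0 hx1
    omega
  have h := (summable_cotTerm hmem).hasSum
  have h1 : ∑' n, cotTerm (x : ℂ) n = Real.pi * Complex.cot (Real.pi * x) - 1 / x := by
    rw [cot_series_rep' hmem]
  rw [h1] at h
  have h2 := (h.mul_left (-1 / 2))
  rw [← Complex.hasSum_ofReal]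
  convert! h2 using 1
  · ext n
    rw [cotTerm]
    have hlt : x < n + 1 := by linarith [(Nat.cast_nonneg n : (0 : ℝ) ≤ n)]
    have ha : (x : ℂ) - (n + 1) ≠ 0 := by
      exact_mod_cast (sub_neg.2 hlt).ne
    have hb : (x : ℂ) + (n + 1) ≠ 0 := by
      exact_mod_cast (by positivity : (0 : ℝ) < x + (n + 1)).ne'
    have hc : ((n : ℂ) + 1) ^ 2 - x ^ 2 ≠ 0 := by
      have := mul_ne_zero ha hb
      contrapose! this
      linear_combination -this
    push_cast
    field_simp
    ring
  · push_cast [Complex.ofReal_cot]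
    ring

theorem hasSum_geometric_odd {x a : ℝ} (hx0 : 0 < x) (hxa : x < a) :
    HasSum (fun m : ℕ => 1 / a ^ (2 * m + 2) * x ^ (2 * m + 1)) (x / (a ^ 2 - x ^ 2)) := by
  have ha : 0 < a := hx0.trans hxa
  have hr : (x / a) ^ 2 < 1 := by
    rw [sq_lt_one_iff₀ (by positivity)]
    exact (div_lt_one ha).2 hxa
  have h := (hasSum_geometric_of_lt_one (by positivity) hr).mul_left (x / a ^ 2)
  have hd : a ^ 2 - x ^ 2 ≠ 0 := (sub_pos.2 (pow_lt_pow_left₀ hxa hx0.le two_ne_zero)).ne'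
  convert! h using 1
  · ext m
    rw [← pow_mul, div_pow]
    field_simp
    ring
  · have : 1 - (x / a) ^ 2 ≠ 0 := (sub_pos.2 hr).ne'
    field_simp

theorem summable_one_div_succ_pow (m : ℕ) :
    Summable fun n : ℕ => 1 / ((n : ℝ) + 1) ^ (2 * m + 2) := by
  have h := (summable_nat_add_iff 1).2
    (Real.summable_one_div_nat_pow.2 (by omega : 1 < 2 * m + 2))
  simpa using h

/-- Each partial fraction of the cotangent is expanded geometrically; nonnegativity of the terms
permits swapping the two sums. -/
theorem hasSum_zeta_mul_pow {x : ℝ} (hx0 : 0 < x) (hx1 : x < 1) :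
    HasSum (fun m : ℕ => (∑' n : ℕ, 1 / ((n : ℝ) + 1) ^ (2 * m + 2)) * x ^ (2 * m + 1))
      ((1 / x - Real.pi * Real.cot (Real.pi * x)) / 2) := by
  have hrow (n : ℕ) := hasSum_geometric_odd hx0
    (by linarith [(Nat.cast_nonneg n : (0 : ℝ) ≤ n)] : x < (n : ℝ) + 1)
  have hcot := hasSum_cot_series hx0 hx1
  have hs : Summable fun p : ℕ × ℕ =>
      1 / ((p.1 : ℝ) + 1) ^ (2 * p.2 + 2) * x ^ (2 * p.2 + 1) := by
    rw [summable_prod_of_nonneg (fun p => by positivity)]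
    refine ⟨fun n => (hrow n).summable, ?_⟩
    simpa only [(hrow _).tsum_eq] using hcot.summable
  have htot := hs.hasSum
  have heq := (htot.prod_fiberwise hrow).unique hcot
  rw [heq] at htot
  have hsw := (Equiv.prodComm ℕ ℕ).hasSum_iff.2 htot
  exact hsw.prod_fiberwise fun m => (summable_one_div_succ_pow m).hasSum.mul_right _

/-- The partial fraction expansion of `tan (π x / 2)`, rearranged as a power series. -/
theorem hasSum_oddZeta_mul_pow {x : ℝ} (hx0 : 0 < x) (hx1 : x < 1) :
    HasSum (fun m : ℕ => oddZeta m * x ^ (2 * m + 1))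
      (Real.pi / 4 * Real.tan (Real.pi * x / 2)) := by
  have h1 := hasSum_zeta_mul_pow hx0 hx1
  -- Since (1/2)(x/2)^(2m+1) = 2^(-(2m+2)) x^(2m+1), subtracting this removes the even n. The closed
  -- form follows from cot θ - 2 cot 2θ = tan θ.
  have h2 := (hasSum_zeta_mul_pow (half_pos hx0) (by linarith)).mul_left (1 / 2)
  convert! h1.sub h2 using 1
  · ext m
    rw [oddZeta, div_pow]
    field_simp
    ring
  · have hs : Real.sin (Real.pi * (x / 2)) ≠ 0 :=
      (Real.sin_pos_of_pos_of_lt_pi (by positivity) (by nlinarith [Real.pi_pos])).ne'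
    have hc : Real.cos (Real.pi * (x / 2)) ≠ 0 :=
      (Real.cos_pos_of_mem_Ioo ⟨by nlinarith [Real.pi_pos], by nlinarith [Real.pi_pos]⟩).ne'
    rw [show Real.pi * x / 2 = Real.pi * (x / 2) by ring,
      show Real.pi * x = 2 * (Real.pi * (x / 2)) by ring, Real.cot_eq_cos_div_sin,
      Real.cot_eq_cos_div_sin, Real.tan_eq_sin_div_cos, Real.sin_two_mul, Real.cos_two_mul']
    generalize Real.pi * (x / 2) = θ at hs hc
    field_simp
    ring

/-! ### Termwise integration -/

theorem oddZeta_nonneg (m : ℕ) : 0 ≤ oddZeta m := by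
  refine mul_nonneg (sub_nonneg.2 ?_) (tsum_nonneg fun n => by positivity)
  rw [div_le_one (by positivity)]
  exact one_le_pow₀ one_le_two

theorem oddZeta_le (m : ℕ) : oddZeta m ≤ ∑' n : ℕ, 1 / ((n : ℝ) + 1) ^ 2 := by
  have h0 : 0 ≤ ∑' n : ℕ, 1 / ((n : ℝ) + 1) ^ (2 * m + 2) := tsum_nonneg fun n => by positivity
  calc oddZeta m ≤ ∑' n : ℕ, 1 / ((n : ℝ) + 1) ^ (2 * m + 2) :=
        mul_le_of_le_one_left h0 (sub_le_self _ (by positivity))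
    _ ≤ _ := by
        refine (summable_one_div_succ_pow m).tsum_le_tsum (fun n => ?_)
          (summable_one_div_succ_pow 0)
        gcongr
        · linarith [(Nat.cast_nonneg n : (0 : ℝ) ≤ n)]
        · omega

theorem summable_oddZeta_div : Summable fun m : ℕ =>
    oddZeta m / ((2 * m + 2) * (2 * m + 3) * (2 * m + 4) * (2 * m + 5)) := by
  refine Summable.of_nonneg_of_le
    (fun m => div_nonneg (oddZeta_nonneg m) (by positivity)) (fun m => ?_)
    ((summable_one_div_succ_pow 0).mul_left (∑' n : ℕ, 1 / ((n : ℝ) + 1) ^ 2))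
  rw [mul_one_div]
  have hm : (0 : ℝ) ≤ m := Nat.cast_nonneg m
  refine div_le_div₀ ((oddZeta_nonneg m).trans (oddZeta_le m)) (oddZeta_le m) (by positivity) ?_
  have h1 : (m + 1 : ℝ) ^ 2 ≤ (2 * m + 2) * (2 * m + 3) := by nlinarith
  have h2 : (1 : ℝ) ≤ (2 * m + 4) * (2 * m + 5) := by nlinarith
  calc ((m : ℝ) + 1) ^ (2 * 0 + 2) ≤ ((2 * m + 2) * (2 * m + 3)) * 1 := by simpa using h1
    _ ≤ ((2 * m + 2) * (2 * m + 3)) * ((2 * m + 4) * (2 * m + 5)) := by gcongr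
    _ = _ := by ring

theorem integral_cube_mul_one_sub_pow (n : ℕ) :
    (∫ x in (0 : ℝ)..1, x ^ 3 * (1 - x) ^ n) = 6 / (((n : ℝ) + 1) * (n + 2) * (n + 3) * (n + 4)) := by
  -- Reflecting x to 1 - x leaves only a cube to expand.
  have h := intervalIntegral.integral_comp_sub_left (a := (0 : ℝ)) (b := 1)
    (fun x : ℝ => (1 - x) ^ 3 * x ^ n) 1
  simp only [sub_sub_cancel, sub_self, sub_zero] at h
  rw [h, intervalIntegral.integral_congr
    (g := fun x : ℝ => x ^ n - 3 * x ^ (n + 1) + 3 * x ^ (n + 2) - x ^ (n + 3))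
    (fun x _ => by ring)]
  rw [intervalIntegral.integral_sub, intervalIntegral.integral_add, intervalIntegral.integral_sub]
  · simp only [intervalIntegral.integral_const_mul, integral_pow]
    push_cast
    simp
    field_simp
    ring
  all_goals exact Continuous.intervalIntegrable (by fun_prop) _ _

theorem hasSum_oddZeta_div :
    HasSum (fun m : ℕ => oddZeta m / ((2 * m + 2) * (2 * m + 3) * (2 * m + 4) * (2 * m + 5)))
      (Real.pi / 24 * ∫ x in (0 : ℝ)..1, x ^ 3 * Real.cot (Real.pi * x / 2)) := by
  let F : ℕ → ℝ → ℝ := fun m x => oddZeta m * (x ^ 3 * (1 - x) ^ (2 * m + 1))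
  have hint (m : ℕ) : ∫ x in Set.Ioo (0 : ℝ) 1, F m x =
      6 * (oddZeta m / ((2 * m + 2) * (2 * m + 3) * (2 * m + 4) * (2 * m + 5))) := by
    rw [← MeasureTheory.integral_Ioc_eq_integral_Ioo,
      ← intervalIntegral.integral_of_le zero_le_one, intervalIntegral.integral_const_mul,
      integral_cube_mul_one_sub_pow]
    push_cast
    ring_nf
  have hF (m : ℕ) : MeasureTheory.Integrable (F m)
      (MeasureTheory.volume.restrict (Set.Ioo (0 : ℝ) 1)) :=
    ((Continuous.integrableOn_Icc (by fun_prop)).mono_set Set.Ioo_subset_Icc_self)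
  have hnorm (m : ℕ) : ∫ x in Set.Ioo (0 : ℝ) 1, ‖F m x‖ = ∫ x in Set.Ioo (0 : ℝ) 1, F m x := by
    refine MeasureTheory.setIntegral_congr_fun measurableSet_Ioo fun x hx => ?_
    have := sub_pos.2 hx.2
    have := hx.1
    exact Real.norm_of_nonneg (mul_nonneg (oddZeta_nonneg m) (by positivity))
  have h := MeasureTheory.hasSum_integral_of_summable_integral_norm hF
    (by simpa only [hnorm, hint] using summable_oddZeta_div.mul_left 6)
  have hlim : ∫ x in Set.Ioo (0 : ℝ) 1, ∑' m, F m x =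
      Real.pi / 4 * ∫ x in (0 : ℝ)..1, x ^ 3 * Real.cot (Real.pi * x / 2) := by
    rw [intervalIntegral.integral_of_le zero_le_one, MeasureTheory.integral_Ioc_eq_integral_Ioo,
      ← MeasureTheory.integral_const_mul]
    refine MeasureTheory.setIntegral_congr_fun measurableSet_Ioo fun x hx => ?_
    have hx' := (hasSum_oddZeta_mul_pow (sub_pos.2 hx.2) (sub_lt_self 1 hx.1)).mul_left (x ^ 3)
    rw [show Real.pi * (1 - x) / 2 = Real.pi / 2 - Real.pi * x / 2 by ring,
      Real.tan_pi_div_two_sub] at hx'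
    have he : (fun m => F m x) = fun m => x ^ 3 * (oddZeta m * (1 - x) ^ (2 * m + 1)) := by
      ext m
      simp only [F]
      ring
    rw [he, hx'.tsum_eq, ← Real.cot_inv_eq_tan, inv_inv]
    ring
  rw [hlim] at h
  simp only [hint] at h
  convert! h.mul_left (1 / 6) using 1
  · ext m; ring
  · ring

/-! ### Alternating sums -/

theorem sum_range_two_mul_neg_one_pow_mul (f : ℕ → ℝ) (N : ℕ) :
    ∑ k ∈ Finset.range (2 * N), (-1 : ℝ) ^ (k + 1) * f (k + 1) =
      2 * ∑ k ∈ Finset.range N, f (2 * (k + 1)) - ∑ k ∈ Finset.range (2 * N), f (k + 1) := by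
  induction N with
  | zero => simp
  | succ N ih =>
    rw [show 2 * (N + 1) = 2 * N + 1 + 1 by ring, Finset.sum_range_succ, Finset.sum_range_succ, ih,
      Finset.sum_range_succ _ N, Finset.sum_range_succ _ (2 * N + 1),
      Finset.sum_range_succ _ (2 * N), show 2 * (N + 1) = 2 * N + 1 + 1 by ring]
    simp only [pow_succ, pow_mul]
    norm_num
    ring

theorem tendsto_two_mul_atTop : Tendsto (fun N : ℕ => 2 * N) atTop atTop :=
  tendsto_id.const_mul_atTop' two_pos

theorem tendsto_sum_neg_one_pow_div :
    Tendsto (fun N : ℕ => ∑ k ∈ Finset.range (2 * N), (-1 : ℝ) ^ (k + 1) * (1 / ((k + 1 : ℕ) : ℝ)))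
      atTop (𝓝 (-Real.log 2)) := by
  have h := Real.tendsto_harmonic_sub_log
  -- The sum equals H_N - H_(2N); the Euler constants cancel, leaving ln N - ln 2N.
  have h2 := (h.sub (h.comp tendsto_two_mul_atTop)).sub_const (Real.log 2)
  rw [sub_self, zero_sub] at h2
  refine h2.congr' ?_
  filter_upwards [eventually_ne_atTop 0] with N hN
  have hN' : (N : ℝ) ≠ 0 := by exact_mod_cast hN
  have e := sum_range_two_mul_neg_one_pow_mul (fun k => 1 / (k : ℝ)) N
  rw [e]
  simp only [Function.comp, harmonic, Nat.cast_mul, Nat.cast_ofNat]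
  rw [Real.log_mul two_ne_zero hN', Finset.mul_sum]
  push_cast
  have : ∀ k : ℕ, 2 * (1 / (2 * ((k : ℝ) + 1))) = ((k : ℝ) + 1)⁻¹ := fun k => by field_simp
  simp only [this]
  simp only [one_div]
  ring

theorem tendsto_sum_neg_one_pow_div_cube :
    Tendsto (fun N : ℕ => ∑ k ∈ Finset.range (2 * N),
        (-1 : ℝ) ^ (k + 1) * (1 / ((k + 1 : ℕ) : ℝ) ^ 3))
      atTop (𝓝 (-(3 / 4) * ∑' n : ℕ, 1 / (n : ℝ) ^ 3)) := by
  have h := (Real.summable_one_div_nat_pow.2 (by norm_num : 1 < 3)).hasSum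
  -- The dropped term n = 0 is 1/0 = 0.
  rw [← hasSum_nat_add_iff' 1] at h
  simp only [Finset.range_one, Finset.sum_singleton, Nat.cast_zero, ne_eq, OfNat.ofNat_ne_zero,
    not_false_eq_true, zero_pow, div_zero, sub_zero] at h
  have h := h.tendsto_sum_nat
  have h2 := (h.const_mul (1 / 4)).sub (h.comp tendsto_two_mul_atTop)
  rw [show ∀ a : ℝ, 1 / 4 * a - a = -(3 / 4) * a from fun a => by ring] at h2
  refine h2.congr fun N => ?_
  have e := sum_range_two_mul_neg_one_pow_mul (fun k => 1 / (k : ℝ) ^ 3) N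
  rw [e, Finset.mul_sum, Finset.mul_sum]
  simp only [Function.comp]
  congr 1
  refine Finset.sum_congr rfl fun k _ => ?_
  push_cast
  field_simp
  norm_num

/-! ### The cotangent integral by Fourier expansion -/

theorem integral_cube_mul_sin {k : ℕ} (hk : k ≠ 0) :
    ∫ x in (0 : ℝ)..1, x ^ 3 * Real.sin (k * Real.pi * x) =
      -((-1 : ℝ) ^ k * (1 / (k : ℝ)) / Real.pi) +
        6 * ((-1 : ℝ) ^ k * (1 / (k : ℝ) ^ 3)) / Real.pi ^ 3 := by
  have hc : (k : ℝ) * Real.pi ≠ 0 := mul_ne_zero (by exact_mod_cast hk) Real.pi_ne_zero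
  have hk' : (k : ℝ) ≠ 0 := by exact_mod_cast hk
  have hs : Real.sin (k * Real.pi) = 0 := Real.sin_nat_mul_pi k
  have hcos : Real.cos (k * Real.pi) = (-1) ^ k := Real.cos_nat_mul_pi k
  -- Antiderivative from repeated integration by parts.
  have hd (x : ℝ) : HasDerivAt
      (fun x : ℝ => (-x ^ 3 / (k * Real.pi) + 6 * x / (k * Real.pi) ^ 3) *
          Real.cos (k * Real.pi * x) +
        (3 * x ^ 2 / (k * Real.pi) ^ 2 - 6 / (k * Real.pi) ^ 4) * Real.sin (k * Real.pi * x))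
      (x ^ 3 * Real.sin (k * Real.pi * x)) x := by
    generalize (k : ℝ) * Real.pi = c at hc
    have hl : HasDerivAt (fun x : ℝ => c * x) c x := by
      simpa using (hasDerivAt_id x).const_mul c
    have h3 : HasDerivAt (fun x : ℝ => x ^ 3) (3 * x ^ 2) x := by simpa using hasDerivAt_pow 3 x
    have h2 : HasDerivAt (fun x : ℝ => x ^ 2) (2 * x) x := by simpa using hasDerivAt_pow 2 x
    have h1 : HasDerivAt (fun x : ℝ => 6 * x) 6 x := by
      simpa using (hasDerivAt_id x).const_mul (6 : ℝ)
    have hp := (h3.neg.div_const c).add (h1.div_const (c ^ 3))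
    have hq := ((h2.const_mul 3).div_const (c ^ 2)).sub_const (6 / c ^ 4)
    convert! (hp.mul hl.cos).add (hq.mul hl.sin) using 1
    simp only [Pi.add_apply, Pi.neg_apply]
    field_simp
    ring
  rw [intervalIntegral.integral_eq_sub_of_hasDerivAt (fun x _ => hd x)
    (Continuous.intervalIntegrable (by fun_prop) _ _)]
  simp only [mul_one, mul_zero, hs, hcos, Real.sin_zero]
  field_simp
  ring

/-- Telescopes, as 2 sin(2kθ) sin θ = cos((2k-1)θ) - cos((2k+1)θ). -/
theorem two_mul_sum_sin_mul_sin (θ : ℝ) (N : ℕ) :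
    2 * (∑ k ∈ Finset.range N, Real.sin (((k + 1 : ℕ) : ℝ) * (2 * θ))) * Real.sin θ =
      Real.cos θ - Real.cos ((2 * N + 1) * θ) := by
  induction N with
  | zero => simp
  | succ N ih =>
    rw [Finset.sum_range_succ, mul_add, add_mul, ih]
    push_cast
    have e1 : (2 * (N : ℝ) + 1) * θ = (N + 1) * (2 * θ) - θ := by ring
    have e2 : (2 * ((N : ℝ) + 1) + 1) * θ = (N + 1) * (2 * θ) + θ := by ring
    rw [e1, e2, Real.cos_sub, Real.cos_add]
    ring

/-- Jordan's inequality; it bounds x³/sin(πx/2) near 0. -/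
theorem le_sin_pi_mul_div_two {x : ℝ} (hx0 : 0 ≤ x) (hx1 : x ≤ 1) :
    x ≤ Real.sin (Real.pi * x / 2) := by
  have h := Real.mul_le_sin (x := Real.pi * x / 2) (by positivity) (by nlinarith [Real.pi_pos])
  have hpi := Real.pi_ne_zero
  convert h using 1
  field_simp

theorem integrableOn_cube_div_sin :
    MeasureTheory.IntegrableOn (fun x : ℝ => x ^ 3 / Real.sin (Real.pi * x / 2))
      (Set.Ioc 0 1) := by
  refine MeasureTheory.IntegrableOn.of_bound (by simp) ?_ 1 ?_
  · exact Measurable.aestronglyMeasurable (by fun_prop)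
  · refine MeasureTheory.ae_restrict_of_forall_mem measurableSet_Ioc fun x hx => ?_
    have h := le_sin_pi_mul_div_two hx.1.le hx.2
    have hx0 := hx.1
    have hs := hx0.trans_le h
    rw [Real.norm_of_nonneg (by positivity), div_le_one hs]
    exact (pow_le_of_le_one hx0.le hx.2 (by norm_num)).trans h

/-- The Riemann–Lebesgue lemma for the cosine on an interval. -/
theorem tendsto_integral_mul_cos {f : ℝ → ℝ} {s : Set ℝ} (hs : MeasurableSet s)
    (hf : MeasureTheory.IntegrableOn f s) :
    Tendsto (fun w : ℝ => ∫ x in s, f x * Real.cos (w * x)) atTop (𝓝 0) := by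
  have h := Real.tendsto_integral_exp_smul_cocompact (s.indicator fun x => (f x : ℂ))
  -- `Real.fourierChar` carries a factor 2π, hence the rescaled frequency.
  have hw : Tendsto (fun w : ℝ => w / (2 * Real.pi)) atTop (cocompact ℝ) :=
    (tendsto_id.atTop_div_const Real.two_pi_pos).mono_right atTop_le_cocompact
  have h2 := (Complex.continuous_re.tendsto 0).comp (h.comp hw)
  rw [Complex.zero_re] at h2
  refine h2.congr fun w => ?_
  have hpi := Real.pi_ne_zero
  have e (x : ℝ) : Real.fourierChar (-(x * (w / (2 * Real.pi)))) •
      s.indicator (fun x => (f x : ℂ)) x =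
      s.indicator (fun x => Complex.exp ((-(w * x) : ℝ) * Complex.I) * (f x : ℂ)) x := by
    by_cases hx : x ∈ s
    · simp only [Set.indicator_of_mem hx, Circle.smul_def, Real.fourierChar_apply, smul_eq_mul]
      congr 4
      field_simp
    · simp [Set.indicator_of_notMem hx]
  simp only [Function.comp, e]
  rw [MeasureTheory.integral_indicator hs, ← RCLike.re_eq_complex_re, ← integral_re]
  · refine MeasureTheory.integral_congr_ae (Eventually.of_forall fun x => ?_)
    simp only [RCLike.re_eq_complex_re, Complex.re_mul_ofReal, Complex.exp_ofReal_mul_I_re,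
      Real.cos_neg]
    ring
  · refine hf.ofReal.bdd_mul (c := 1) ?_ ?_
    · exact Continuous.aestronglyMeasurable (by fun_prop)
    · exact Eventually.of_forall fun x => (Complex.norm_exp_ofReal_mul_I _).le

theorem integral_cube_mul_cot_sub_sum (N : ℕ) :
    (∫ x in (0 : ℝ)..1, x ^ 3 * Real.cot (Real.pi * x / 2)) -
      2 * ∑ k ∈ Finset.range N,
        ∫ x in (0 : ℝ)..1, x ^ 3 * Real.sin (((k + 1 : ℕ) : ℝ) * Real.pi * x) =
    ∫ x in Set.Ioc (0 : ℝ) 1, x ^ 3 / Real.sin (Real.pi * x / 2) *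
      Real.cos ((2 * N + 1) * (Real.pi / 2) * x) := by
  rw [← intervalIntegral.integral_finsetSum
      (fun k _ => Continuous.intervalIntegrable (by fun_prop) _ _),
    ← intervalIntegral.integral_const_mul, ← intervalIntegral.integral_sub,
    intervalIntegral.integral_of_le zero_le_one]
  · refine MeasureTheory.setIntegral_congr_fun measurableSet_Ioc fun x hx => ?_
    have hs := (hx.1.trans_le (le_sin_pi_mul_div_two hx.1.le hx.2)).ne'
    have h := two_mul_sum_sin_mul_sin (Real.pi * x / 2) N
    have e (k : ℕ) : ((k + 1 : ℕ) : ℝ) * Real.pi * x =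
        ((k + 1 : ℕ) : ℝ) * (2 * (Real.pi * x / 2)) := by ring
    rw [← Finset.mul_sum, Real.cot_eq_cos_div_sin, eq_add_of_sub_eq h.symm,
      show (2 * (N : ℝ) + 1) * (Real.pi / 2) * x = (2 * N + 1) * (Real.pi * x / 2) by ring]
    simp only [e]
    generalize ∑ k ∈ Finset.range N, Real.sin (((k + 1 : ℕ) : ℝ) * (2 * (Real.pi * x / 2))) = S
    generalize Real.pi * x / 2 = θ at hs
    field_simp
    ring
  · rw [intervalIntegrable_iff_integrableOn_Ioc_of_le zero_le_one]
    have h : MeasureTheory.IntegrableOn (fun x : ℝ => Real.cos (Real.pi * x / 2) *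
        (x ^ 3 / Real.sin (Real.pi * x / 2))) (Set.Ioc 0 1) :=
      integrableOn_cube_div_sin.bdd_mul (c := 1)
        (Continuous.aestronglyMeasurable (by fun_prop))
        (Eventually.of_forall fun x => Real.abs_cos_le_one _)
    refine h.congr (Eventually.of_forall fun x => ?_)
    simp only [Real.cot_eq_cos_div_sin]
    ring
  · exact Continuous.intervalIntegrable (by fun_prop) _ _

theorem integral_cube_mul_cot :
    ∫ x in (0 : ℝ)..1, x ^ 3 * Real.cot (Real.pi * x / 2) =
      2 * Real.log 2 / Real.pi - 9 / Real.pi ^ 3 * ∑' n : ℕ, 1 / (n : ℝ) ^ 3 := by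
  -- Only even cutoffs 2N are used, matching the alternating sums.
  have hfreq : Tendsto (fun N : ℕ => (2 * ((2 * N : ℕ) : ℝ) + 1) * (Real.pi / 2)) atTop atTop := by
    refine Tendsto.atTop_mul_const (by positivity) (tendsto_atTop_add_const_right _ _ ?_)
    exact (tendsto_natCast_atTop_atTop.comp tendsto_two_mul_atTop).const_mul_atTop two_pos
  have hRL := (tendsto_integral_mul_cos measurableSet_Ioc integrableOn_cube_div_sin).comp hfreq
  have hsum := ((tendsto_sum_neg_one_pow_div.div_const Real.pi).neg.add
    ((tendsto_sum_neg_one_pow_div_cube.const_mul 6).div_const (Real.pi ^ 3))).const_mul 2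
  have hadd := hRL.add hsum
  refine (tendsto_nhds_unique (hadd.congr fun N => ?_) tendsto_const_nhds).symm.trans
    (b := 0 + 2 * (-(-Real.log 2 / Real.pi) +
      6 * (-(3 / 4) * ∑' n : ℕ, 1 / (n : ℝ) ^ 3) / Real.pi ^ 3)) ?_
  · simp only [Function.comp]
    rw [← integral_cube_mul_cot_sub_sum (2 * N),
      Finset.sum_congr rfl fun k _ => integral_cube_mul_sin (Nat.succ_ne_zero k),
      Finset.sum_add_distrib, Finset.sum_neg_distrib, ← Finset.sum_div, ← Finset.sum_div,
      ← Finset.mul_sum]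
    simp only [Nat.succ_eq_add_one]
    ring
  · ring

/-- The Dancs–He series for `ζ(3)`: the series converges, and
`(π² / 9) ln 4 - (2 π⁴ / 3) ∑_{m ≥ 0} (-1)^m π^{2m} E_{2m+1}(1) / (2m+5)! = ζ(3)`. -/
theorem theorem2 :
    Summable (fun m : ℕ => (-1 : ℝ) ^ m * (Real.pi ^ (2 * m) / ((2 * m + 5).factorial : ℝ)) *
      (((eulerPolynomial (2 * m + 1)).eval 1 : ℚ) : ℝ)) ∧
    ((Real.pi ^ 2 / 9 * Real.log 4 - 2 * Real.pi ^ 4 / 3 *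
      ∑' m : ℕ, (-1 : ℝ) ^ m * (Real.pi ^ (2 * m) / ((2 * m + 5).factorial : ℝ)) *
        (((eulerPolynomial (2 * m + 1)).eval 1 : ℚ) : ℝ) : ℝ) : ℂ) = riemannZeta 3 := by
  have h := hasSum_oddZeta_div.mul_left (4 / Real.pi ^ 2)
  rw [integral_cube_mul_cot] at h
  simp only [eulerPolynomial_eval_one_eq_oddZeta]
  refine ⟨h.summable, ?_⟩
  have hz : riemannZeta 3 = ((∑' n : ℕ, 1 / (n : ℝ) ^ 3 : ℝ) : ℂ) := by
    have := zeta_nat_eq_tsum_of_gt_one (k := 3) (by norm_num)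
    push_cast at this ⊢
    exact this
  rw [h.tsum_eq, hz, Complex.ofReal_inj, show (4 : ℝ) = 2 ^ 2 by norm_num, Real.log_pow]
  have hpi := Real.pi_ne_zero
  field_simp
  push_cast
  ring
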